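/- A metric graph is a space obtained from closed intervals $I_e=[0,\ell_e]$ (the edges $e\in E$) by gluing their endpoints at nodes $v\in V$; multiple edges and self-loops are allowed. It is compact if it has finitely many nodes and edges and every edge has finite length $\ell_e>0$. The degree of a node is the number of edge ends at it (a self-loop counts twice), and a terminal edge is an edge one of whose endpoints is a node of degree one. For $u:\mathcal G\to\mathbb R$ let $u_e:I_e\to\mathbb R$ be its restriction to the edge $e$. Let $$H^1(\mathcal G)=\{u:\mathcal G\to\mathbb R \text{ continuous}: u_e\in H^1(0,\ell_e)\ \forall e\in E\},$$ $$\|u\|_p^p=\sum_{e\in E}\int_0^{\ell_e}|u_e|^p\,dx,\qquad \|u'\|_2^2=\sum_{e\in E}\int_0^{\ell_e}|u_e'|^2\,dx,\qquad H^1_\mu(\mathcal G)=\{u\in H^1(\mathcal G):\|u\|_2^2=\mu\},$$ and let $\mu_{\mathbb R}=\sqrt3\,\pi/2$ (the $L^2$-critical mass of the real line). **Proposition.** Let $\mathcal G$ be a connected compact metric graph with no terminal edge. Then there is a constant $C>0$, depending only on $\mathcal G$, such that for every $\mu\in(0,\mu_{\mathbb R}]$ and every $u\in H^1_\mu(\mathcal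 G)$ there exists $\theta=\theta(u)\in[0,\mu]$ with $$\|u\|_6^6\le 3\Big(\frac{\mu-\theta}{\mu_{\mathbb R}}\Big)^2\|u'\|_2^2+C\,\theta^{1/2}.$$ -/

import Mathlib

open scoped ContDiff

/-- `g` is a weak derivative of `f` on the open interval `(a, b)`, tested against smooth functions
with compact support contained in `(a, b)`. -/
def HasWeakDerivOn (f g : ℝ → ℝ) (a b : ℝ) : Prop :=
  ∀ φ : ℝ → ℝ, ContDiff ℝ ∞ φ → HasCompactSupport φ → tsupport φ ⊆ Set.Ioo a b →
    ∫ x in Set.Ioo a b, f x * deriv φ x = -∫ x in Set.Ioo a b, g x * φ x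

/-- `g` is a weak derivative of `f` on `(a, b)` and `g ∈ L²(a, b)`. -/
def HasL2WeakDerivOn (f g : ℝ → ℝ) (a b : ℝ) : Prop :=
  MeasureTheory.MemLp g 2 (MeasureTheory.volume.restrict (Set.Ioo a b)) ∧ HasWeakDerivOn f g a b

/-- The Sobolev space `H¹(a, b)`: `f ∈ L²(a, b)` with a weak derivative in `L²(a, b)`. -/
def MemH1 (f : ℝ → ℝ) (a b : ℝ) : Prop :=
  MeasureTheory.MemLp f 2 (MeasureTheory.volume.restrict (Set.Ioo a b)) ∧
    ∃ g : ℝ → ℝ, HasL2WeakDerivOn f g a b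

open Classical in
/-- A representative of the weak derivative of `f` on `(a, b)`, if `f` has one in `L²(a, b)`
(and `0` otherwise). It is unique up to a.e. equality, see `HasL2WeakDerivOn.ae_eq`. -/
noncomputable def weakDeriv (f : ℝ → ℝ) (a b : ℝ) : ℝ → ℝ :=
  if h : ∃ g : ℝ → ℝ, HasL2WeakDerivOn f g a b then h.choose else 0

theorem MemH1.hasL2WeakDerivOn {f : ℝ → ℝ} {a b : ℝ} (h : MemH1 f a b) :
    HasL2WeakDerivOn f (weakDeriv f a b) a b := by
  rw [weakDeriv, dif_pos h.2]
  exact h.2.choose_spec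

theorem HasL2WeakDerivOn.ae_eq {f g₁ g₂ : ℝ → ℝ} {a b : ℝ} (h₁ : HasL2WeakDerivOn f g₁ a b)
    (h₂ : HasL2WeakDerivOn f g₂ a b) :
    g₁ =ᵐ[MeasureTheory.volume.restrict (Set.Ioo a b)] g₂ := by
  have i₁ : MeasureTheory.IntegrableOn g₁ (Set.Ioo a b) := h₁.1.integrable (by norm_num)
  have i₂ : MeasureTheory.IntegrableOn g₂ (Set.Ioo a b) := h₂.1.integrable (by norm_num)
  have key := IsOpen.ae_eq_zero_of_integral_contDiff_smul_eq_zero (μ := MeasureTheory.volume)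
    (f := fun x => g₁ x - g₂ x) (isOpen_Ioo (a := a) (b := b))
    (MeasureTheory.IntegrableOn.locallyIntegrableOn (i₁.sub i₂)) (by
      intro φ hφ hc hs
      have e₁ := h₁.2 φ hφ hc hs
      have e₂ := h₂.2 φ hφ hc hs
      obtain ⟨M, hM⟩ := hφ.continuous.bounded_above_of_compact_support hc
      have j₁ : MeasureTheory.IntegrableOn (fun x => g₁ x * φ x) (Set.Ioo a b) :=
        i₁.mul_bdd hφ.continuous.aestronglyMeasurable (Filter.Eventually.of_forall hM)
      have j₂ : MeasureTheory.IntegrableOn (fun x => g₂ x * φ x) (Set.Ioo a b) :=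
        i₂.mul_bdd hφ.continuous.aestronglyMeasurable (Filter.Eventually.of_forall hM)
      have hz : ∫ x in Set.Ioo a b, φ x • (g₁ x - g₂ x) = 0 := by
        have : (fun x => φ x • (g₁ x - g₂ x)) = fun x => g₁ x * φ x - g₂ x * φ x := by
          funext x; simp only [smul_eq_mul]; ring
        rw [this, MeasureTheory.integral_sub j₁ j₂]
        linarith
      rw [← hz]
      refine (MeasureTheory.setIntegral_eq_integral_of_forall_compl_eq_zero fun x hx => ?_).symm
      rw [image_eq_zero_of_notMem_tsupport fun hx' => hx (hs hx'), zero_smul])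
  rw [Filter.EventuallyEq, MeasureTheory.ae_restrict_iff' measurableSet_Ioo]
  filter_upwards [key] with x hx hxm
  exact sub_eq_zero.mp (hx hxm)

/-- A metric graph with vertex set `V` and edge set `E`, all of whose edges have finite positive
length. Edge `e` is the interval `[0, len e]`, with `0` glued to `src e` and `len e` glued to
`tgt e`; multiple edges and self-loops are allowed. It is compact when `V` and `E` are finite. -/
structure MetricGraph (V E : Type*) where
  src : E → V
  tgt : E → V
  len : E → ℝ
  len_pos : ∀ e, 0 < len e

namespace MetricGraph

variable {V E : Type*} (G : MetricGraph V E)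

/-- Vertices together with the disjoint union of the edge intervals, before gluing. -/
abbrev PreSpace : Type _ := V ⊕ (Σ e : E, Set.Icc (0 : ℝ) (G.len e))

/-- The gluing of the endpoints of the edges to the vertices. -/
inductive Glue : G.PreSpace → G.PreSpace → Prop
  | src (e : E) : Glue (Sum.inr ⟨e, ⟨0, le_refl 0, (G.len_pos e).le⟩⟩) (Sum.inl (G.src e))
  | tgt (e : E) : Glue (Sum.inr ⟨e, ⟨G.len e, (G.len_pos e).le, le_refl _⟩⟩) (Sum.inl (G.tgt e))

/-- The underlying space of the graph. -/
def Space : Type _ := Quot G.Glue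

/-- The quotient topology (the vertex set being discrete). -/
instance : TopologicalSpace G.Space :=
  letI : TopologicalSpace V := ⊥
  inferInstanceAs (TopologicalSpace (Quot G.Glue))

/-- The point with coordinate `x` on the edge `e`. -/
def edgePoint (e : E) (x : Set.Icc (0 : ℝ) (G.len e)) : G.Space :=
  Quot.mk G.Glue (Sum.inr ⟨e, x⟩)

/-- The graph is connected: it has a vertex, and any two vertices are joined by a path. -/
def Connected : Prop :=
  (SimpleGraph.fromRel fun v w : V => ∃ e, G.src e = v ∧ G.tgt e = w).Connected

/-- The degree of a vertex: the number of edge ends at it, a self-loop being counted twice. -/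
noncomputable def degree (v : V) : ℕ :=
  Nat.card {e : E // G.src e = v} + Nat.card {e : E // G.tgt e = v}

/-- An edge is terminal if one of its endpoints is a vertex of degree one. -/
def IsTerminalEdge (e : E) : Prop :=
  G.degree (G.src e) = 1 ∨ G.degree (G.tgt e) = 1

variable {G}

/-- The restriction `u_e` of `u` to the edge `e`, as a function of the coordinate in `[0, len e]`
(extended to `ℝ` by its endpoint values). -/
noncomputable def edgeFun (u : G.Space → ℝ) (e : E) : ℝ → ℝ :=
  Set.IccExtend (G.len_pos e).le fun x => u (G.edgePoint e x)

/-- `u ∈ H¹(G)`: `u` is continuous on `G` and `u_e ∈ H¹(0, len e)` for every edge `e`. -/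
def InH1 (u : G.Space → ℝ) : Prop :=
  Continuous u ∧ ∀ e, MemH1 (edgeFun u e) 0 (G.len e)

variable [Fintype E]

/-- `‖u‖_p ^ p` in `L^p(G)`. -/
noncomputable def lpNormPow (p : ℕ) (u : G.Space → ℝ) : ℝ :=
  ∑ e, ∫ x in Set.Ioo 0 (G.len e), |edgeFun u e x| ^ p

/-- `‖u'‖_2 ^ 2` in `L²(G)`. -/
noncomputable def derivNormSq (u : G.Space → ℝ) : ℝ :=
  ∑ e, ∫ x in Set.Ioo 0 (G.len e), weakDeriv (edgeFun u e) 0 (G.len e) x ^ 2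

/-- `u ∈ H¹_μ(G)`: `u ∈ H¹(G)` and `‖u‖_2 ^ 2 = μ`. -/
def InH1Mass (μ : ℝ) (u : G.Space → ℝ) : Prop :=
  InH1 u ∧ lpNormPow 2 u = μ

end MetricGraph

/-- The critical mass `μ_ℝ` of the real line. -/
noncomputable def criticalMassLine : ℝ := √3 * Real.pi / 2

open MeasureTheory Set intervalIntegral

/-! Let M be the maximum of |u|. Since |u| ≤ M, the density k²u'² + u²(M⁴ - u⁴) is nonnegative and,
by a² + b² ≥ 2ab, at least 2k|(Φ∘u)'|, where Φ = `calibration M` is a primitive of t√(M⁴ - t⁴) with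
Φ(M) = πM⁴/8. On the line u decays from its maximum in both directions, so the total energy is at
least 4kΦ(M) = kπM⁴/2. This energy equals k²‖u'‖₂² + M⁴μ - ‖u‖₆⁶, so k = 2μ/π cancels the M⁴ terms
and leaves the sharp Gagliardo–Nirenberg constant.

On a compact graph u need not reach zero. For large M and bounded mass, however, either the energy
is already large enough or u nearly vanishes within length r; `calibration_tail` thus recovers Φ of
the initial value up to O(M⁻⁴). Without terminal edges, two routes with disjoint interiors leave the
maximum point and each ends in such a tail (`two_mul_calibration_le_energy`). Finally
`exists_mass_defect` absorbs O(M⁻⁴) into √θ with θ = M⁻⁸; the remaining regimes follow from ‖u‖₆⁶ ≤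
M⁴μ or need no loss of mass. -/

/-- A Lipschitz function of an absolutely continuous function is absolutely continuous. -/
theorem AbsolutelyContinuousOnInterval.lipschitzOnWith_comp {F f : ℝ → ℝ} {a b : ℝ} {s : Set ℝ}
    {K : NNReal} (hf : AbsolutelyContinuousOnInterval f a b) (hF : LipschitzOnWith K F s)
    (hs : MapsTo f (uIcc a b) s) : AbsolutelyContinuousOnInterval (F ∘ f) a b := by
  rw [absolutelyContinuousOnInterval_iff] at hf ⊢
  intro ε hε
  obtain ⟨δ, hδ, h⟩ := hf (ε / (K + 1)) (by positivity)
  refine ⟨δ, hδ, fun I hI hlt => ?_⟩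
  have h1 := h I hI hlt
  rw [lt_div_iff₀ (by positivity)] at h1
  calc ∑ i ∈ Finset.range I.1, dist ((F ∘ f) (I.2 i).1) ((F ∘ f) (I.2 i).2)
      ≤ ∑ i ∈ Finset.range I.1, (K + 1) * dist (f (I.2 i).1) (f (I.2 i).2) := by
        refine Finset.sum_le_sum fun i hi => ?_
        have hm := hI.1 i hi
        refine (hF.dist_le_mul _ (hs hm.1) _ (hs hm.2)).trans ?_
        gcongr
        linarith
    _ < ε := by rw [← Finset.mul_sum]; linarith

/-! ### The calibration -/

/-- The signed area under the unit semicircle over `[0, y]`. -/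
noncomputable def semicircleArea (y : ℝ) : ℝ := ∫ s in (0 : ℝ)..y, √(1 - s ^ 2)

theorem continuous_sqrt_one_sub_sq : Continuous fun s : ℝ => √(1 - s ^ 2) := by fun_prop

theorem hasDerivAt_semicircleArea (y : ℝ) : HasDerivAt semicircleArea (√(1 - y ^ 2)) y :=
  integral_hasDerivAt_right (continuous_sqrt_one_sub_sq.intervalIntegrable _ _)
    continuous_sqrt_one_sub_sq.aestronglyMeasurable.stronglyMeasurableAtFilter
    continuous_sqrt_one_sub_sq.continuousAt

theorem semicircleArea_le {y : ℝ} (hy : 0 ≤ y) : semicircleArea y ≤ y := by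
  have h := integral_mono_on (a := 0) (b := y) (μ := volume) hy
    (continuous_sqrt_one_sub_sq.intervalIntegrable _ _)
    (continuous_const (y := (1 : ℝ)).intervalIntegrable _ _)
    (fun s _ => Real.sqrt_le_one.2 (by nlinarith [sq_nonneg s]))
  simpa [semicircleArea] using h

theorem semicircleArea_one : semicircleArea 1 = Real.pi / 4 := by
  have h := integral_sqrt_one_sub_sq
  rw [← integral_add_adjacent_intervals (b := 0)
    (continuous_sqrt_one_sub_sq.intervalIntegrable _ _)
    (continuous_sqrt_one_sub_sq.intervalIntegrable _ _)] at h
  have h2 := integral_comp_neg (a := (0 : ℝ)) (b := 1) fun s : ℝ => √(1 - s ^ 2)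
  simp only [neg_sq, neg_zero] at h2
  rw [← h2] at h
  unfold semicircleArea
  linarith

/-- The calibration of the functional with potential `t ^ 2 * (M ^ 4 - t ^ 4)`. -/
noncomputable def calibration (M t : ℝ) : ℝ := M ^ 4 / 2 * semicircleArea (t ^ 2 / M ^ 2)

/-- The derivative of `calibration M`. -/
noncomputable def calibrationDeriv (M t : ℝ) : ℝ := M ^ 2 * t * √(1 - (t ^ 2 / M ^ 2) ^ 2)

/-- No bound on `t` is needed: `√` vanishes on negative numbers, so the semicircle area is constant
beyond ±1 and the calibration is C¹ on the whole line. -/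
theorem hasDerivAt_calibration {M : ℝ} (hM : 0 < M) (t : ℝ) :
    HasDerivAt (calibration M) (calibrationDeriv M t) t := by
  have h := ((hasDerivAt_semicircleArea (t ^ 2 / M ^ 2)).comp t
    ((hasDerivAt_pow 2 t).div_const (M ^ 2))).const_mul (M ^ 4 / 2)
  refine HasDerivAt.congr_deriv (f := calibration M) h ?_
  simp only [calibrationDeriv]
  push_cast
  field_simp

theorem calibrationDeriv_sq {M t : ℝ} (hM : 0 < M) (ht : |t| ≤ M) :
    calibrationDeriv M t ^ 2 = t ^ 2 * (M ^ 4 - t ^ 4) := by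
  have h2 : t ^ 2 / M ^ 2 ≤ 1 := by
    rw [div_le_one (by positivity)]
    exact sq_le_sq' (by linarith [neg_le_of_abs_le ht]) (le_of_abs_le ht)
  have h0 : 0 ≤ t ^ 2 / M ^ 2 := by positivity
  rw [calibrationDeriv, mul_pow, Real.sq_sqrt (by nlinarith)]
  field_simp

theorem potential_nonneg {M t : ℝ} (hM : 0 < M) (ht : |t| ≤ M) : 0 ≤ t ^ 2 * (M ^ 4 - t ^ 4) := by
  rw [← calibrationDeriv_sq hM ht]; positivity

theorem lipschitzOnWith_calibration {M : ℝ} (hM : 0 < M) :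
    ∃ K, LipschitzOnWith K (calibration M) (Icc (-M) M) := by
  have hd : deriv (calibration M) = calibrationDeriv M :=
    funext fun t => (hasDerivAt_calibration hM t).deriv
  have hc : ContDiff ℝ 1 (calibration M) := by
    refine contDiff_one_iff_deriv.2
      ⟨fun t => (hasDerivAt_calibration hM t).differentiableAt, ?_⟩
    rw [hd]
    unfold calibrationDeriv
    fun_prop
  exact hc.contDiffOn.exists_lipschitzOnWith (by simp) (convex_Icc _ _) isCompact_Icc

/-- This quadratic bound at zero turns smallness of f² into smallness of the calibration at the end
of a tail. -/
theorem calibration_le {M : ℝ} (hM : 0 < M) (t : ℝ) : calibration M t ≤ M ^ 2 * t ^ 2 / 2 := by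
  refine (mul_le_mul_of_nonneg_left (semicircleArea_le (y := t ^ 2 / M ^ 2) (by positivity))
    (by positivity)).trans (le_of_eq ?_)
  field_simp

theorem calibration_of_abs_eq {M t : ℝ} (hM : 0 < M) (ht : |t| = M) :
    calibration M t = Real.pi / 8 * M ^ 4 := by
  have : t ^ 2 / M ^ 2 = 1 := by rw [← ht, sq_abs, div_self]; rw [← sq_abs, ht]; positivity
  rw [calibration, this, semicircleArea_one]
  ring

/-! ### Decay along a tail -/

/-- If a nonnegative energy density controls the potential and the calibration, then its integral
over an interval of length `r` controls the whole calibration of the initial value, up to an error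
that is small for large `M`. -/
theorem calibration_tail {f h : ℝ → ℝ} {r k M m : ℝ} (hr : 0 < r) (hk : 0 ≤ k) (hM : 0 < M)
    (hbig : 8 * m ≤ r * M ^ 2) (fcont : ContinuousOn f (Icc 0 r))
    (hf : ∀ x ∈ Icc 0 r, |f x| ≤ M) (hint : IntervalIntegrable h volume 0 r)
    (hV : ∀ x ∈ Icc 0 r, f x ^ 2 * (M ^ 4 - f x ^ 4) ≤ h x)
    (hmass : ∫ x in (0 : ℝ)..r, f x ^ 2 ≤ m)
    (hstat : ∀ z ∈ Icc 0 r,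
      2 * k * (calibration M (f 0) - calibration M (f z)) ≤ ∫ x in (0 : ℝ)..z, h x) :
    2 * k * calibration M (f 0) - k * (8 * k / r) ^ 4 / M ^ 4 ≤ ∫ x in (0 : ℝ)..r, h x := by
  -- If the bound fails, the total energy is below 2kΦ(f 0). With `hstat`, the energy to the right
  -- of any z is then at most 2kΦ(f z) ≤ kM² f(z)², which forces decay.
  by_contra hcon
  have hsmall : ∫ x in (0 : ℝ)..r, h x < 2 * k * calibration M (f 0) :=
    (not_le.1 hcon).trans_le (by
      have : 0 ≤ k * (8 * k / r) ^ 4 / M ^ 4 := by positivity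
      linarith)
  have hh0 : ∀ x ∈ Icc 0 r, 0 ≤ h x := fun x hx => (potential_nonneg hM (hf x hx)).trans (hV x hx)
  have hsub : ∀ {x y}, 0 ≤ x → x ≤ y → y ≤ r → IntervalIntegrable h volume x y := by
    intro x y hx hxy hy
    refine hint.mono_set ?_
    rw [uIcc_of_le hxy, uIcc_of_le hr.le]
    exact Icc_subset_Icc hx hy
  have hnn : ∀ {x y}, 0 ≤ x → x ≤ y → y ≤ r → 0 ≤ ∫ t in x..y, h t := fun hx hxy hy =>
    integral_nonneg hxy fun t ht => hh0 t ⟨hx.trans ht.1, ht.2.trans hy⟩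
  have fint : ∀ {x y}, 0 ≤ x → x ≤ y → y ≤ r →
      IntervalIntegrable (fun t => f t ^ 2) volume x y := by
    intro x y hx hxy hy
    refine ContinuousOn.intervalIntegrable ?_
    rw [uIcc_of_le hxy]
    exact (fcont.mono (Icc_subset_Icc hx hy)).pow 2
  have key : ∀ z ∈ Icc 0 r, ∀ a, 0 ≤ a → z ≤ a → a + r / 4 ≤ r → ∃ w ∈ Icc a (a + r / 4),
      f w ^ 2 ≤ 8 * k / (r * M ^ 2) * f z ^ 2 := by
    intro z hz a ha hza har
    obtain ⟨w, hw, hmin⟩ := isCompact_Icc.exists_isMinOn (nonempty_Icc.2 (by linarith : a ≤ a + r / 4))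
      ((fcont.mono (Icc_subset_Icc ha har)).pow 2)
    refine ⟨w, hw, ?_⟩
    have hle : a ≤ a + r / 4 := by linarith
    have e1 : ∫ x in (0 : ℝ)..r, h x =
        (∫ x in (0 : ℝ)..z, h x) + (∫ x in z..a, h x) + (∫ x in a..(a + r / 4), h x)
          + ∫ x in (a + r / 4)..r, h x := by
      rw [integral_add_adjacent_intervals (hsub le_rfl hz.1 hz.2) (hsub hz.1 hza (by linarith)),
        integral_add_adjacent_intervals (hsub le_rfl ha (by linarith)) (hsub ha hle har),
        integral_add_adjacent_intervals (hsub le_rfl (by linarith) har)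
          (hsub (by linarith) har le_rfl)]
    have n1 := hnn hz.1 hza (by linarith)
    have n2 := hnn (x := a + r / 4) (y := r) (by linarith) har le_rfl
    have s1 := hstat z hz
    have c1 := mul_le_mul_of_nonneg_left (calibration_le hM (f z)) (by positivity : 0 ≤ 2 * k)
    have mass1 : ∫ x in a..(a + r / 4), f x ^ 2 ≤ m := by
      refine le_trans ?_ hmass
      refine integral_mono_interval ha hle har ?_ (fint le_rfl hr.le le_rfl)
      exact Filter.Eventually.of_forall fun x => by positivity
    -- With A = f(w)² ≤ B = f(x)² ≤ M², the difference of the two sides is (M² - B)(B² + M²(B - A))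
    -- ≥ 0. After integration `hbig` lets the mass term consume at most half of the main term.
    have g1 : ∫ x in a..(a + r / 4), (f w ^ 2 * M ^ 4 - f w ^ 2 * M ^ 2 * f x ^ 2) ≤
        ∫ x in a..(a + r / 4), h x := by
      refine integral_mono_on hle (intervalIntegrable_const.sub
        ((fint ha hle har).const_mul _)) (hsub ha hle har) fun x hx => ?_
      have hxr : x ∈ Icc 0 r := ⟨ha.trans hx.1, hx.2.trans har⟩
      refine le_trans ?_ (hV x hxr)
      have q1 : f w ^ 2 ≤ f x ^ 2 := hmin hx
      have q2 : f x ^ 2 ≤ M ^ 2 := sq_le_sq.2 (by rw [abs_of_pos hM]; exact hf x hxr)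
      have q3 : 0 ≤ f w ^ 2 := by positivity
      nlinarith [mul_nonneg (mul_nonneg (q3.trans q1) (q3.trans q1)) (sub_nonneg.2 q2),
        mul_nonneg (mul_nonneg (sub_nonneg.2 q1) (sub_nonneg.2 q2)) (sq_nonneg M)]
    rw [integral_sub intervalIntegrable_const ((fint ha hle har).const_mul _),
      intervalIntegral.integral_const, intervalIntegral.integral_const_mul,
      smul_eq_mul] at g1
    have hw0 : 0 ≤ f w ^ 2 * M ^ 2 := by positivity
    have g2 := mul_le_mul_of_nonneg_left mass1 hw0
    have g3 := mul_le_mul_of_nonneg_left hbig hw0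
    have g4 : f w ^ 2 * M ^ 4 * r / 8 ≤ k * M ^ 2 * f z ^ 2 := by nlinarith
    rw [div_mul_eq_mul_div, le_div_iff₀ (by positivity)]
    have : 0 < M ^ 2 := by positivity
    refine le_of_mul_le_mul_left ?_ this
    nlinarith
  have q0 : 0 ≤ 8 * k / (r * M ^ 2) := by positivity
  -- Each quarter of `[0, r]` gains a factor of order M⁻². Four gains bring kM² f² from order M⁴
  -- down to M⁻⁴, the order required by the choice θ = M⁻⁸.
  obtain ⟨w1, hw1, b1⟩ := key 0 ⟨le_rfl, hr.le⟩ 0 le_rfl le_rfl (by linarith)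
  obtain ⟨w2, hw2, b2⟩ := key w1 ⟨by linarith [hw1.1], by linarith [hw1.2]⟩ (r / 4) (by linarith)
    (by linarith [hw1.2]) (by linarith)
  obtain ⟨w3, hw3, b3⟩ := key w2 ⟨by linarith [hw2.1], by linarith [hw2.2]⟩ (r / 2) (by linarith)
    (by linarith [hw2.2]) (by linarith)
  obtain ⟨w4, hw4, b4⟩ := key w3 ⟨by linarith [hw3.1], by linarith [hw3.2]⟩ (3 * r / 4)
    (by linarith) (by linarith [hw3.2]) (by linarith)
  have hw4' : w4 ∈ Icc 0 r := ⟨by linarith [hw4.1], by linarith [hw4.2]⟩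
  have b0 : f 0 ^ 2 ≤ M ^ 2 :=
    sq_le_sq.2 (by rw [abs_of_pos hM]; exact hf 0 ⟨le_rfl, hr.le⟩)
  have b5 : f w4 ^ 2 ≤ (8 * k / (r * M ^ 2)) ^ 4 * M ^ 2 := by
    calc f w4 ^ 2 ≤ 8 * k / (r * M ^ 2) * (8 * k / (r * M ^ 2) * (8 * k / (r * M ^ 2) *
          (8 * k / (r * M ^ 2) * M ^ 2))) := by
          refine b4.trans (mul_le_mul_of_nonneg_left (b3.trans (mul_le_mul_of_nonneg_left
            (b2.trans (mul_le_mul_of_nonneg_left (b1.trans (mul_le_mul_of_nonneg_left b0 q0)) q0))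
            q0)) q0)
      _ = _ := by ring
  have s4 := hstat w4 hw4'
  have c4 := mul_le_mul_of_nonneg_left (calibration_le hM (f w4)) (by positivity : 0 ≤ 2 * k)
  have d4 := mul_le_mul_of_nonneg_left b5 (by positivity : 0 ≤ k * M ^ 2)
  have d5 : k * M ^ 2 * ((8 * k / (r * M ^ 2)) ^ 4 * M ^ 2) = k * (8 * k / r) ^ 4 / M ^ 4 := by
    field_simp
  have e4 : ∫ x in (0 : ℝ)..r, h x = (∫ x in (0 : ℝ)..w4, h x) + ∫ x in w4..r, h x :=
    (integral_add_adjacent_intervals (hsub le_rfl hw4'.1 hw4'.2) (hsub hw4'.1 hw4'.2 le_rfl)).symm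
  have n4 := hnn hw4'.1 hw4'.2 le_rfl
  refine hcon ?_
  nlinarith

/-! ### From weak derivatives to absolute continuity -/

/-- A smooth function whose support lies in a compact subinterval and whose integral vanishes has a
smooth compactly supported primitive. -/
theorem exists_compactlySupported_primitive {ψ : ℝ → ℝ} {a b : ℝ} (hab : a < b)
    (hψ : ContDiff ℝ ∞ ψ) (hc : HasCompactSupport ψ) (hs : tsupport ψ ⊆ Ioo a b)
    (h0 : ∫ x in a..b, ψ x = 0) :
    ∃ φ : ℝ → ℝ, ContDiff ℝ ∞ φ ∧ HasCompactSupport φ ∧ tsupport φ ⊆ Ioo a b ∧ deriv φ = ψ := by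
  have hd : ∀ x, HasDerivAt (fun x => ∫ t in a..x, ψ t) (ψ x) x := fun x =>
    integral_hasDerivAt_right (hψ.continuous.intervalIntegrable _ _)
      hψ.continuous.aestronglyMeasurable.stronglyMeasurableAtFilter hψ.continuous.continuousAt
  have hd' : deriv (fun x => ∫ t in a..x, ψ t) = ψ := funext fun x => (hd x).deriv
  obtain ⟨a', b', ha', hb', hsub⟩ : ∃ a' b', a < a' ∧ b' < b ∧ tsupport ψ ⊆ Icc a' b' := by
    rcases (tsupport ψ).eq_empty_or_nonempty with he | hne
    · exact ⟨(a + b) / 2, (a + b) / 2, by linarith, by linarith, by simp [he]⟩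
    · obtain ⟨p, hp, hpm⟩ := hc.isCompact.exists_isLeast hne
      obtain ⟨q, hq, hqm⟩ := hc.isCompact.exists_isGreatest hne
      exact ⟨p, q, (hs hp).1, (hs hq).2, fun x hx => ⟨hpm hx, hqm hx⟩⟩
  have hz : ∀ x, x ∉ Icc a' b' → ψ x = 0 := fun x hx =>
    image_eq_zero_of_notMem_tsupport fun h => hx (hsub h)
  have hsupp : Function.support (fun x => ∫ t in a..x, ψ t) ⊆ Icc a' b' := by
    intro x hx
    by_contra hxn
    refine hx ?_
    rcases lt_or_ge x a' with hlt | hge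
    · refine (integral_congr (g := fun _ => 0) fun t ht => hz t fun h => ?_).trans (by simp)
      have : t ≤ max a x := ht.2
      exact absurd (h.1.trans this) (not_le.2 (max_lt ha' hlt))
    · have hbx : b' < x := not_le.1 fun h => hxn ⟨hge, h⟩
      change ∫ t in a..x, ψ t = 0
      -- Past the support the primitive equals the full integral of ψ, which is zero.
      rw [← integral_add_adjacent_intervals (hψ.continuous.intervalIntegrable a b)
        (hψ.continuous.intervalIntegrable b x), h0, zero_add]
      refine (integral_congr (g := fun _ => 0) fun t ht => hz t fun h => ?_).trans (by simp)
      have : min b x ≤ t := ht.1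
      exact absurd (this.trans h.2) (not_le.2 (lt_min hb' hbx))
  have hts : tsupport (fun x => ∫ t in a..x, ψ t) ⊆ Icc a' b' :=
    closure_minimal hsupp isClosed_Icc
  refine ⟨fun x => ∫ t in a..x, ψ t, ?_, ?_, ?_, hd'⟩
  · refine contDiff_infty_iff_deriv.2 ⟨fun x => (hd x).differentiableAt, ?_⟩
    rw [hd']
    exact hψ
  · exact isCompact_Icc.of_isClosed_subset (isClosed_tsupport _) hts
  · exact hts.trans fun x hx => ⟨ha'.trans_le hx.1, hx.2.trans_lt hb'⟩

/-- A continuous function with vanishing weak derivative on an interval is constant there. -/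
theorem HasWeakDerivOn.eqOn_const {h : ℝ → ℝ} {a b : ℝ} (hab : a < b)
    (hcont : ContinuousOn h (Icc a b)) (hw : HasWeakDerivOn h (fun _ => 0) a b) :
    ∃ c, EqOn h (fun _ => c) (Icc a b) := by
  -- A test function of integral one: subtracting q times it from ψ gives mean zero, hence the
  -- derivative of a test function. The constant is the average of `h` against it.
  let B : ContDiffBump ((a + b) / 2) := ⟨(b - a) / 8, (b - a) / 4, by linarith, by linarith⟩
  have hB : ContDiff ℝ ∞ (B.normed volume) := B.contDiff_normed
  have hBc : HasCompactSupport (B.normed volume) := B.hasCompactSupport_normed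
  have hBs : tsupport (B.normed volume) ⊆ Ioo a b := by
    rw [B.tsupport_normed_eq, Real.closedBall_eq_Icc]
    change Icc ((a + b) / 2 - (b - a) / 4) ((a + b) / 2 + (b - a) / 4) ⊆ _
    exact fun x hx => ⟨by linarith [hx.1], by linarith [hx.2]⟩
  have hBi : ∫ x in Ioo a b, B.normed volume x = 1 := by
    rw [setIntegral_eq_integral_of_forall_compl_eq_zero fun x hx =>
      image_eq_zero_of_notMem_tsupport fun hx' => hx (hBs hx'), B.integral_normed]
  have hi : IntegrableOn h (Ioo a b) := (hcont.integrableOn_Icc).mono_set Ioo_subset_Icc_self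
  have hmul : ∀ φ : ℝ → ℝ, Continuous φ → HasCompactSupport φ →
      IntegrableOn (fun x => h x * φ x) (Ioo a b) := fun φ hφ hc => by
    obtain ⟨C, hC⟩ := hφ.bounded_above_of_compact_support hc
    exact hi.mul_bdd hφ.aestronglyMeasurable (Filter.Eventually.of_forall hC)
  have hII : ∀ φ : ℝ → ℝ, Continuous φ → IntegrableOn φ (Ioo a b) := fun φ hφ =>
    (hφ.integrableOn_Icc).mono_set Ioo_subset_Icc_self
  set c := ∫ x in Ioo a b, h x * B.normed volume x with hcdef
  refine ⟨c, ?_⟩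
  have key := IsOpen.ae_eq_zero_of_integral_contDiff_smul_eq_zero (μ := volume)
    (f := fun x => h x - c) (isOpen_Ioo (a := a) (b := b))
    (IntegrableOn.locallyIntegrableOn (hi.sub (hII _ continuous_const))) (by
      intro ψ hψ hc hs
      set q := ∫ x in Ioo a b, ψ x with hq
      have hη : ContDiff ℝ ∞ fun x => ψ x - q * B.normed volume x :=
        hψ.sub (contDiff_const.mul hB)
      have hsup : tsupport (fun x => ψ x - q * B.normed volume x) ⊆
          tsupport ψ ∪ tsupport (B.normed volume) := by
        refine closure_minimal (fun x hx => ?_)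
          ((isClosed_tsupport _).union (isClosed_tsupport _))
        by_contra hn
        rw [mem_union, not_or] at hn
        exact hx (by simp only [image_eq_zero_of_notMem_tsupport hn.1,
          image_eq_zero_of_notMem_tsupport hn.2, mul_zero, sub_zero])
      obtain ⟨φ, hφ, hφc, hφs, hφd⟩ := exists_compactlySupported_primitive hab hη
        ((hc.isCompact.union hBc.isCompact).of_isClosed_subset (isClosed_tsupport _) hsup)
        (hsup.trans (union_subset hs hBs)) (by
          rw [integral_of_le hab.le, integral_Ioc_eq_integral_Ioo,
            integral_sub (hII _ hψ.continuous) ((hII _ hB.continuous).const_mul q),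
            MeasureTheory.integral_const_mul, hBi]
          simp [hq])
      have e := hw φ hφ hφc hφs
      rw [hφd] at e
      have e2 : ∫ x in Ioo a b, h x * (ψ x - q * B.normed volume x) =
          (∫ x in Ioo a b, h x * ψ x) - q * c := by
        rw [hcdef, ← MeasureTheory.integral_const_mul, ← MeasureTheory.integral_sub
          (hmul ψ hψ.continuous hc) ((hmul _ hB.continuous hBc).const_mul q)]
        congr 1
        funext x
        ring
      rw [e2] at e
      simp only [zero_mul, integral_zero, neg_zero] at e
      rw [← setIntegral_eq_integral_of_forall_compl_eq_zero (s := Ioo a b) fun x hx => by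
        rw [image_eq_zero_of_notMem_tsupport fun hx' => hx (hs hx'), zero_smul]]
      have e3 : ∫ x in Ioo a b, ψ x • (h x - c) = (∫ x in Ioo a b, h x * ψ x) - c * q := by
        rw [hq, ← MeasureTheory.integral_const_mul, ← MeasureTheory.integral_sub
          (hmul ψ hψ.continuous hc) ((hII _ hψ.continuous).const_mul c)]
        congr 1
        funext x
        simp only [smul_eq_mul]
        ring
      rw [e3]
      linarith)
  refine Measure.eqOn_Icc_of_ae_eq (μ := volume) hab.ne ?_ hcont continuousOn_const
  rw [← restrict_Ioo_eq_restrict_Icc, Filter.EventuallyEq, ae_restrict_iff' measurableSet_Ioo]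
  filter_upwards [key] with x hx hxm
  exact sub_eq_zero.1 (hx hxm)

/-- A continuous function in `H¹(a, b)` agrees on `[a, b]` with an absolutely continuous function
whose derivative is almost everywhere the weak derivative. -/
theorem MemH1.exists_absolutelyContinuous {f : ℝ → ℝ} {a b : ℝ} (hab : a < b)
    (hcont : ContinuousOn f (Icc a b)) (hf : MemH1 f a b) :
    ∃ F : ℝ → ℝ, AbsolutelyContinuousOnInterval F a b ∧
      (∀ᵐ x, x ∈ uIcc a b → HasDerivAt F (weakDeriv f a b x) x) ∧ EqOn F f (Icc a b) := by
  obtain ⟨hg2, hw⟩ := hf.hasL2WeakDerivOn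
  set g := weakDeriv f a b with hgdef
  have hgi : IntegrableOn g (Ioo a b) := hg2.integrable (by norm_num)
  have hgI : IntervalIntegrable g volume a b :=
    (intervalIntegrable_iff_integrableOn_Ioo_of_le hab.le).2 hgi
  let P : ℝ → ℝ := fun x => ∫ t in a..x, g t
  have hP : AbsolutelyContinuousOnInterval P a b :=
    hgI.absolutelyContinuousOnInterval_intervalIntegral left_mem_uIcc
  have hPd : ∀ᵐ x, x ∈ uIcc a b → HasDerivAt P (g x) x := by
    filter_upwards [hgI.ae_hasDerivAt_integral] with x hx hxm
    exact hx hxm a left_mem_uIcc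
  have hPc : ContinuousOn P (Icc a b) := by
    have := hP.continuousOn
    rwa [uIcc_of_le hab.le] at this
  have hcw : HasWeakDerivOn (fun x => f x - P x) (fun _ => 0) a b := by
    intro φ hφ hφc hφs
    have hdc : Continuous (deriv φ) := hφ.continuous_deriv (by simp)
    have hz : ∀ x, x ∉ Ioo a b → φ x = 0 := fun x hx =>
      image_eq_zero_of_notMem_tsupport fun h => hx (hφs h)
    have hφac : AbsolutelyContinuousOnInterval φ a b :=
      (hφ.of_le (by simp)).contDiffOn.absolutelyContinuousOnInterval
    have ibp := hP.integral_mul_deriv_eq_deriv_mul hφac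
    rw [hz a (by simp), hz b (by simp), mul_zero, mul_zero, sub_zero, zero_sub] at ibp
    have e1 : ∫ x in a..b, deriv P x * φ x = ∫ x in a..b, g x * φ x := by
      refine integral_congr_ae ?_
      filter_upwards [hPd] with x hx hxm
      rw [(hx (uIoc_subset_uIcc hxm)).deriv]
    rw [e1, integral_of_le hab.le, integral_of_le hab.le, integral_Ioc_eq_integral_Ioo,
      integral_Ioc_eq_integral_Ioo, ← hw φ hφ hφc hφs] at ibp
    have i1 : IntegrableOn (fun x => f x * deriv φ x) (Ioo a b) :=
      ((hcont.mul hdc.continuousOn).integrableOn_Icc).mono_set Ioo_subset_Icc_self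
    have i2 : IntegrableOn (fun x => P x * deriv φ x) (Ioo a b) :=
      ((hPc.mul hdc.continuousOn).integrableOn_Icc).mono_set Ioo_subset_Icc_self
    simp only [sub_mul]
    rw [MeasureTheory.integral_sub i1 i2, ibp]
    simp
  obtain ⟨c, hc⟩ := hcw.eqOn_const hab (hcont.sub hPc)
  refine ⟨fun x => c + P x, ?_, ?_, ?_⟩
  · exact (LipschitzWith.const c).lipschitzOnWith.absolutelyContinuousOnInterval.fun_add hP
  · filter_upwards [hPd] with x hx hxm
    exact (hx hxm).const_add c
  · intro x hx
    have h : f x - P x = c := hc hx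
    change c + P x = f x
    linarith

/-! ### Energy on an interval -/

/-- `f` is absolutely continuous on `[a, b]` with square integrable derivative `g`, it is bounded
by `M`, and its mass is at most `m`. -/
structure BoundedSobolev (f g : ℝ → ℝ) (M m a b : ℝ) : Prop where
  absolutelyContinuous : AbsolutelyContinuousOnInterval f a b
  hasDerivAt : ∀ᵐ x, x ∈ uIcc a b → HasDerivAt f (g x) x
  sq_intervalIntegrable : IntervalIntegrable (fun x => g x ^ 2) volume a b
  abs_le : ∀ x ∈ Icc a b, |f x| ≤ M
  mass_le : ∫ x in a..b, f x ^ 2 ≤ m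

/-- The energy density `k² f'² + f² (M⁴ - f⁴)`. -/
def energyDensity (k M : ℝ) (f g : ℝ → ℝ) (x : ℝ) : ℝ :=
  k ^ 2 * g x ^ 2 + f x ^ 2 * (M ^ 4 - f x ^ 4)

theorem potential_le_energyDensity (k M : ℝ) (f g : ℝ → ℝ) (x : ℝ) :
    f x ^ 2 * (M ^ 4 - f x ^ 4) ≤ energyDensity k M f g x :=
  le_add_of_nonneg_left (by positivity)

namespace BoundedSobolev

variable {f g : ℝ → ℝ} {k M m r a b c d : ℝ}

theorem continuousOn (H : BoundedSobolev f g M m a b) (hab : a ≤ b) : ContinuousOn f (Icc a b) := by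
  have := H.absolutelyContinuous.continuousOn
  rwa [uIcc_of_le hab] at this

theorem mono (H : BoundedSobolev f g M m a b) (hac : a ≤ c) (hcd : c ≤ d) (hdb : d ≤ b) :
    BoundedSobolev f g M m c d := by
  have hab : a ≤ b := hac.trans (hcd.trans hdb)
  have hsub : uIcc c d ⊆ uIcc a b := by
    rw [uIcc_of_le hcd, uIcc_of_le hab]
    exact Icc_subset_Icc hac hdb
  refine ⟨H.absolutelyContinuous.mono hsub, ?_, H.sq_intervalIntegrable.mono_set hsub,
    fun x hx => H.abs_le x ⟨hac.trans hx.1, hx.2.trans hdb⟩, le_trans ?_ H.mass_le⟩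
  · filter_upwards [H.hasDerivAt] with x hx hxm using hx (hsub hxm)
  · refine integral_mono_interval hac hcd hdb (Filter.Eventually.of_forall fun x => ?_)
      (H.absolutelyContinuous.continuousOn.pow 2).intervalIntegrable
    simpa using sq_nonneg (f x)

theorem intervalIntegrable_energyDensity (H : BoundedSobolev f g M m a b) (k : ℝ) :
    IntervalIntegrable (energyDensity k M f g) volume a b := by
  have hc := H.absolutelyContinuous.continuousOn
  exact (H.sq_intervalIntegrable.const_mul _).add
    ((hc.pow 2).mul (continuousOn_const.sub (hc.pow 4))).intervalIntegrable

theorem energyDensity_nonneg (H : BoundedSobolev f g M m a b) (hM : 0 < M) (k : ℝ) {x : ℝ}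
    (hx : x ∈ Icc a b) : 0 ≤ energyDensity k M f g x :=
  (potential_nonneg hM (H.abs_le x hx)).trans (potential_le_energyDensity k M f g x)

theorem integral_energyDensity_nonneg (H : BoundedSobolev f g M m a b) (hM : 0 < M) (k : ℝ)
    (hab : a ≤ b) : 0 ≤ ∫ x in a..b, energyDensity k M f g x :=
  integral_nonneg hab fun _ hx => H.energyDensity_nonneg hM k hx

theorem integral_energyDensity_split (H : BoundedSobolev f g M m a b) (k : ℝ) (hac : a ≤ c)
    (hcb : c ≤ b) : (∫ x in a..c, energyDensity k M f g x) + (∫ x in c..b, energyDensity k M f g x) =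
      ∫ x in a..b, energyDensity k M f g x :=
  integral_add_adjacent_intervals ((H.mono le_rfl hac hcb).intervalIntegrable_energyDensity k)
    ((H.mono hac hcb le_rfl).intervalIntegrable_energyDensity k)

/-- The energy on an interval controls the variation of the calibration. -/
theorem abs_calibration_sub_le (H : BoundedSobolev f g M m a b) (hM : 0 < M) (hk : 0 ≤ k)
    (hab : a ≤ b) :
    2 * k * |calibration M (f b) - calibration M (f a)| ≤
      ∫ x in a..b, energyDensity k M f g x := by
  obtain ⟨K, hK⟩ := lipschitzOnWith_calibration hM
  have hmaps : MapsTo f (uIcc a b) (Icc (-M) M) := fun x hx => by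
    rw [uIcc_of_le hab] at hx
    exact _root_.abs_le.1 (H.abs_le x hx)
  have hac := H.absolutelyContinuous.lipschitzOnWith_comp hK hmaps
  have hint := hac.integral_deriv_eq_sub
  have hpt : ∀ᵐ x, x ∈ uIoc a b →
      2 * k * |deriv (calibration M ∘ f) x| ≤ energyDensity k M f g x := by
    filter_upwards [H.hasDerivAt] with x hx hxm
    have hxu := uIoc_subset_uIcc hxm
    rw [((hasDerivAt_calibration hM (f x)).comp x (hx hxu)).deriv, energyDensity,
      ← calibrationDeriv_sq hM (_root_.abs_le.2 (hmaps hxu)), abs_mul, ← sq_abs (g x),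
      ← sq_abs (calibrationDeriv M (f x))]
    -- Equality holds when k|f'| = |Φ'(f)|, the equation of the optimal profile; this is why the
    -- calibration loses no constant.
    nlinarith [sq_nonneg (k * |g x| - |calibrationDeriv M (f x)|)]
  calc 2 * k * |calibration M (f b) - calibration M (f a)|
      = 2 * k * |∫ x in a..b, deriv (calibration M ∘ f) x| := by rw [hint]; rfl
    _ ≤ 2 * k * ∫ x in a..b, |deriv (calibration M ∘ f) x| := by
        gcongr
        exact abs_integral_le_integral_abs hab
    _ = ∫ x in a..b, 2 * k * |deriv (calibration M ∘ f) x| :=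
        (intervalIntegral.integral_const_mul _ _).symm
    _ ≤ _ := by
        refine integral_mono_ae_restrict hab (hac.intervalIntegrable_deriv.abs.const_mul _)
          (H.intervalIntegrable_energyDensity k) ?_
        rw [Filter.EventuallyLE, ← restrict_Ioc_eq_restrict_Icc,
          ae_restrict_iff' measurableSet_Ioc]
        rw [uIoc_of_le hab] at hpt
        exact hpt

/-- The variation bound supplies `hstat` for the tail estimate; the energy beyond `a + r` is
nonnegative and is discarded. -/
theorem calibration_left_le (H : BoundedSobolev f g M m a b) (hM : 0 < M) (hk : 0 ≤ k)
    (hr : 0 < r) (hab : a + r ≤ b) (hbig : 8 * m ≤ r * M ^ 2) :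
    2 * k * calibration M (f a) - k * (8 * k / r) ^ 4 / M ^ 4 ≤
      ∫ x in a..b, energyDensity k M f g x := by
  have har : a ≤ a + r := by linarith
  have H' := H.mono le_rfl har hab
  have hmem : ∀ x ∈ Icc 0 r, a + x ∈ Icc a (a + r) := fun x hx =>
    ⟨by linarith [hx.1], by linarith [hx.2]⟩
  have key := calibration_tail (f := fun x => f (a + x)) (h := fun x => energyDensity k M f g (a + x))
    hr hk hM hbig ((H'.continuousOn har).comp (by fun_prop) hmem)
    (fun x hx => H'.abs_le _ (hmem x hx))
    (by simpa using (H'.intervalIntegrable_energyDensity k).comp_add_left a)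
    (fun x _ => potential_le_energyDensity k M f g _)
    (by rw [integral_comp_add_left (fun x => f x ^ 2), add_zero]; exact H'.mass_le)
    (fun z hz => by
      rw [integral_comp_add_left (energyDensity k M f g), add_zero]
      refine le_trans ?_ ((H'.mono le_rfl (hmem z hz).1 (hmem z hz).2).abs_calibration_sub_le hM hk
        (hmem z hz).1)
      rw [abs_sub_comm]
      exact mul_le_mul_of_nonneg_left (le_abs_self _) (by positivity))
  rw [integral_comp_add_left (energyDensity k M f g), add_zero] at key
  rw [← H.integral_energyDensity_split k har hab]
  exact key.trans (le_add_of_nonneg_right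
    ((H.mono har hab le_rfl).integral_energyDensity_nonneg hM k hab))

theorem calibration_right_le (H : BoundedSobolev f g M m a b) (hM : 0 < M) (hk : 0 ≤ k)
    (hr : 0 < r) (hab : a + r ≤ b) (hbig : 8 * m ≤ r * M ^ 2) :
    2 * k * calibration M (f b) - k * (8 * k / r) ^ 4 / M ^ 4 ≤
      ∫ x in a..b, energyDensity k M f g x := by
  have har : a ≤ b - r := by linarith
  have hrb : b - r ≤ b := by linarith
  have H' := H.mono har hrb le_rfl
  have hmem : ∀ x ∈ Icc 0 r, b - x ∈ Icc (b - r) b := fun x hx =>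
    ⟨by linarith [hx.2], by linarith [hx.1]⟩
  have key := calibration_tail (f := fun x => f (b - x)) (h := fun x => energyDensity k M f g (b - x))
    hr hk hM hbig ((H'.continuousOn hrb).comp (by fun_prop) hmem)
    (fun x hx => H'.abs_le _ (hmem x hx))
    (by simpa using ((H'.intervalIntegrable_energyDensity k).comp_sub_left b).symm)
    (fun x _ => potential_le_energyDensity k M f g _)
    (by rw [integral_comp_sub_left (fun x => f x ^ 2), sub_zero]; exact H'.mass_le)
    (fun z hz => by
      rw [integral_comp_sub_left (energyDensity k M f g), sub_zero]
      refine le_trans ?_ ((H'.mono (hmem z hz).1 (hmem z hz).2 le_rfl).abs_calibration_sub_le hM hk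
        (hmem z hz).2)
      exact mul_le_mul_of_nonneg_left (le_abs_self _) (by positivity))
  rw [integral_comp_sub_left (energyDensity k M f g), sub_zero] at key
  rw [← H.integral_energyDensity_split k har hrb]
  exact key.trans (le_add_of_nonneg_left
    ((H.mono le_rfl har hrb).integral_energyDensity_nonneg hM k har))

end BoundedSobolev

/-! ### Energy on a graph without terminal edges -/

namespace MetricGraph

variable {V E : Type*} {G : MetricGraph V E}

/-- The second alternative allows `e' = e`: the far end of a self-loop is a different edge end at
the same vertex. -/
theorem exists_ne_edgeEnd_src [Finite E] {e : E} (h : G.degree (G.src e) ≠ 1) :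
    (∃ e', e' ≠ e ∧ G.src e' = G.src e) ∨ ∃ e', G.tgt e' = G.src e := by
  by_contra! hn
  refine h ?_
  have h1 : Nat.card {e' : E // G.src e' = G.src e} = 1 :=
    Nat.card_eq_one_iff_unique.2 ⟨⟨fun x y => Subtype.ext ((not_imp_not.1 (hn.1 x.1) x.2).trans
      (not_imp_not.1 (hn.1 y.1) y.2).symm)⟩, ⟨⟨e, rfl⟩⟩⟩
  have h2 : Nat.card {e' : E // G.tgt e' = G.src e} = 0 :=
    Nat.card_eq_zero.2 (Or.inl ⟨fun x => hn.2 x.1 x.2⟩)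
  rw [degree, h1, h2]

theorem exists_ne_edgeEnd_tgt [Finite E] {e : E} (h : G.degree (G.tgt e) ≠ 1) :
    (∃ e', e' ≠ e ∧ G.tgt e' = G.tgt e) ∨ ∃ e', G.src e' = G.tgt e := by
  by_contra! hn
  refine h ?_
  have h1 : Nat.card {e' : E // G.tgt e' = G.tgt e} = 1 :=
    Nat.card_eq_one_iff_unique.2 ⟨⟨fun x y => Subtype.ext ((not_imp_not.1 (hn.1 x.1) x.2).trans
      (not_imp_not.1 (hn.1 y.1) y.2).symm)⟩, ⟨⟨e, rfl⟩⟩⟩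
  have h2 : Nat.card {e' : E // G.src e' = G.tgt e} = 0 :=
    Nat.card_eq_zero.2 (Or.inl ⟨fun x => hn.2 x.1 x.2⟩)
  rw [degree, h1, h2]

variable [Fintype E]

/-- On a graph without terminal edges, the energy of a function attaining the bound `M` controls
twice the calibration of `M`, as on the real line, up to an error that is small for large `M`. -/
theorem two_mul_calibration_le_energy (hterm : ∀ e, ¬ G.IsTerminalEdge e) {F g : E → ℝ → ℝ}
    {w : V → ℝ} {k M m r x₀ : ℝ} {e₀ : E}
    (H : ∀ e, BoundedSobolev (F e) (g e) M m 0 (G.len e)) (hsrc : ∀ e, F e 0 = w (G.src e))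
    (htgt : ∀ e, F e (G.len e) = w (G.tgt e)) (hM : 0 < M) (hk : 0 ≤ k) (hr : 0 < r)
    (hlen : ∀ e, 4 * r ≤ G.len e) (hbig : 8 * m ≤ r * M ^ 2) (hx₀ : x₀ ∈ Icc 0 (G.len e₀))
    (hmax : |F e₀ x₀| = M) :
    k * (Real.pi / 2 * M ^ 4) - 2 * (k * (8 * k / r) ^ 4 / M ^ 4) ≤
      ∑ e, ∫ x in (0 : ℝ)..G.len e, energyDensity k M (F e) (g e) x := by
  classical
  have hnn : ∀ e, 0 ≤ ∫ x in (0 : ℝ)..G.len e, energyDensity k M (F e) (g e) x := fun e =>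
    (H e).integral_energyDensity_nonneg hM k (G.len_pos e).le
  have hone : ∀ e, ∫ x in (0 : ℝ)..G.len e, energyDensity k M (F e) (g e) x ≤
      ∑ e, ∫ x in (0 : ℝ)..G.len e, energyDensity k M (F e) (g e) x := fun e =>
    Finset.single_le_sum (fun i _ => hnn i) (Finset.mem_univ e)
  have htwo : ∀ e, e ≠ e₀ → (∫ x in (0 : ℝ)..G.len e, energyDensity k M (F e) (g e) x) +
      (∫ x in (0 : ℝ)..G.len e₀, energyDensity k M (F e₀) (g e₀) x) ≤
      ∑ e, ∫ x in (0 : ℝ)..G.len e, energyDensity k M (F e) (g e) x := fun e he => by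
    rw [← Finset.sum_pair (f := fun e => ∫ x in (0 : ℝ)..G.len e, energyDensity k M (F e) (g e) x) he]
    exact Finset.sum_le_sum_of_subset_of_nonneg (Finset.subset_univ _) fun i _ _ => hnn i
  have hcal := calibration_of_abs_eq hM hmax
  have hlen0 := hlen e₀
  have hleft : ∀ e, 2 * k * calibration M (w (G.src e)) - k * (8 * k / r) ^ 4 / M ^ 4 ≤
      ∫ x in (0 : ℝ)..G.len e, energyDensity k M (F e) (g e) x := fun e => by
    rw [← hsrc]
    exact (H e).calibration_left_le hM hk hr (by linarith [hlen e]) hbig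
  have hright : ∀ e, 2 * k * calibration M (w (G.tgt e)) - k * (8 * k / r) ^ 4 / M ^ 4 ≤
      ∫ x in (0 : ℝ)..G.len e, energyDensity k M (F e) (g e) x := fun e => by
    rw [← htgt]
    exact (H e).calibration_right_le hM hk hr (by linarith [hlen e]) hbig
  have hvarl := ((H e₀).mono le_rfl hx₀.1 hx₀.2).abs_calibration_sub_le hM hk hx₀.1
  have hvarr := ((H e₀).mono hx₀.1 hx₀.2 le_rfl).abs_calibration_sub_le hM hk hx₀.2
  have habsl := mul_le_mul_of_nonneg_left
    (le_abs_self (calibration M (F e₀ x₀) - calibration M (F e₀ 0))) (by positivity : 0 ≤ 2 * k)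
  have habsr := mul_le_mul_of_nonneg_left
    (neg_abs_le (calibration M (F e₀ (G.len e₀)) - calibration M (F e₀ x₀)))
    (by positivity : 0 ≤ 2 * k)
  rw [hsrc, hcal] at habsl
  rw [htgt, hcal] at habsr
  rw [hsrc, hcal] at hvarl
  rw [htgt, hcal] at hvarr
  have hsplit := (H e₀).integral_energyDensity_split k hx₀.1 hx₀.2
  -- The far half of `e₀` holds a tail starting at the maximum. Toward the near vertex the variation
  -- bound gives 2k(Φ(M) - Φ(w)), w being the value there, and a tail from another edge end at that
  -- vertex restores 2kΦ(w).
  rcases le_total x₀ (G.len e₀ / 2) with hx | hx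
  · have hfar : ∀ c, x₀ + r ≤ c → c ≤ G.len e₀ →
        2 * k * (Real.pi / 8 * M ^ 4) - k * (8 * k / r) ^ 4 / M ^ 4 ≤
          ∫ x in x₀..c, energyDensity k M (F e₀) (g e₀) x := fun c hc1 hc2 => by
      rw [← hcal]
      exact ((H e₀).mono hx₀.1 (by linarith) hc2).calibration_left_le hM hk hr hc1 hbig
    rcases exists_ne_edgeEnd_src fun h => hterm e₀ (Or.inl h) with ⟨e, hne, he⟩ | ⟨e, he⟩
    · have h1 := hleft e
      rw [he] at h1
      linarith [htwo e hne, hfar (G.len e₀) (by linarith) le_rfl]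
    -- For a self-loop the last stretch of length r is the second tail. Since x₀ ≤ len/2 and 4r ≤
    -- len, the stretch between x₀ and it still has length at least r for the first.
    · by_cases hne : e = e₀
      · subst hne
        have hc : x₀ ≤ G.len e - r := by linarith
        have hc' : G.len e - r ≤ G.len e := by linarith
        have h1 := ((H e).mono (hx₀.1.trans hc) hc' le_rfl).calibration_right_le hM hk hr
          (by linarith) hbig
        rw [htgt, he] at h1
        have h2 := ((H e).mono hx₀.1 hx₀.2 le_rfl).integral_energyDensity_split k hc hc'
        linarith [hone e, hfar (G.len e - r) (by linarith) hc']
      · have h1 := hright e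
        rw [he] at h1
        linarith [htwo e hne, hfar (G.len e₀) (by linarith) le_rfl]
  · have hfar : ∀ c, 0 ≤ c → c + r ≤ x₀ →
        2 * k * (Real.pi / 8 * M ^ 4) - k * (8 * k / r) ^ 4 / M ^ 4 ≤
          ∫ x in c..x₀, energyDensity k M (F e₀) (g e₀) x := fun c hc1 hc2 => by
      rw [← hcal]
      exact ((H e₀).mono hc1 (by linarith) hx₀.2).calibration_right_le hM hk hr hc2 hbig
    rcases exists_ne_edgeEnd_tgt fun h => hterm e₀ (Or.inr h) with ⟨e, hne, he⟩ | ⟨e, he⟩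
    · have h1 := hright e
      rw [he] at h1
      linarith [htwo e hne, hfar 0 le_rfl (by linarith)]
    · by_cases hne : e = e₀
      · subst hne
        have hc : r ≤ x₀ := by linarith
        have h1 := ((H e).mono le_rfl hr.le (hc.trans hx₀.2)).calibration_left_le hM hk hr
          (by linarith) hbig
        rw [hsrc, he] at h1
        have h2 := ((H e).mono le_rfl hx₀.1 hx₀.2).integral_energyDensity_split k hr.le hc
        linarith [hone e, hfar r hr.le (by linarith)]
      · have h1 := hleft e
        rw [he] at h1
        linarith [htwo e hne, hfar 0 le_rfl (by linarith)]

end MetricGraph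

/-! ### Trading the error for mass, and the critical constant -/

/-- A bound with an error `C₁ / M⁴` can be traded for a loss of mass `θ`. -/
theorem exists_mass_defect {μ N D M R C₁ κ : ℝ} (hμ : 0 < μ) (hμ3 : μ ≤ 3) (hM : 0 < M)
    (hR : 1 ≤ R) (hC₁ : 0 ≤ C₁) (hκ : 0 ≤ κ) (hD : 0 ≤ D) (h₁ : N ≤ M ^ 4 * μ)
    (h₂ : R ≤ M → N ≤ κ * μ ^ 2 * D + C₁ / M ^ 4) :
    ∃ θ ∈ Icc 0 μ, N ≤ κ * (μ - θ) ^ 2 * D + (C₁ + 2 * R ^ 4 + 2) * √θ := by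
  have hs := Real.sq_sqrt hμ.le
  have hs0 : 0 ≤ √μ := Real.sqrt_nonneg μ
  have hR4 : 1 ≤ R ^ 4 := one_le_pow₀ hR
  rcases lt_or_ge M R with hMR | hMR
  -- For bounded M, N ≤ R⁴μ ≤ 2R⁴√μ because √μ ≤ 2.
  · refine ⟨μ, ⟨hμ.le, le_rfl⟩, ?_⟩
    have hs2 : √μ ≤ 2 := Real.sqrt_le_iff.2 ⟨by norm_num, by linarith⟩
    have hM4 : M ^ 4 ≤ R ^ 4 := by gcongr
    have e1 : N ≤ R ^ 4 * √μ ^ 2 := by rw [hs]; exact h₁.trans (by gcongr)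
    nlinarith [mul_nonneg (mul_nonneg (by positivity : 0 ≤ R ^ 4) hs0) (sub_nonneg.2 hs2),
      mul_nonneg hC₁ hs0]
  · rcases lt_or_ge (μ * M ^ 8) 1 with h8 | h8
    · refine ⟨μ, ⟨hμ.le, le_rfl⟩, ?_⟩
      have e0 : M ^ 4 * √μ ≤ 1 := by
        refine abs_le_of_sq_le_sq' (b := 1) ?_ zero_le_one |>.2
        rw [mul_pow, hs]
        nlinarith
      have e1 : N ≤ M ^ 4 * √μ * √μ := by rw [mul_assoc, ← sq, hs]; exact h₁
      nlinarith [mul_nonneg (sub_nonneg.2 e0) hs0, mul_nonneg hC₁ hs0,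
        mul_nonneg (by positivity : 0 ≤ R ^ 4) hs0]
    · rcases le_or_gt (M ^ 4 * μ) (κ * μ ^ 2 * D) with hbig | hsmall
      · exact ⟨0, ⟨le_rfl, hμ.le⟩, by simpa using h₁.trans hbig⟩
      -- Here √θ = M⁻⁴. Replacing μ by μ - θ costs at most 2κμDθ, and κμD ≤ M⁴ bounds this by 2√θ.
      · refine ⟨1 / M ^ 8, ⟨by positivity, by rw [div_le_iff₀ (by positivity)]; exact h8⟩, ?_⟩
        have hsq : √(1 / M ^ 8) = 1 / M ^ 4 := by
          rw [show 1 / M ^ 8 = (1 / M ^ 4) ^ 2 by ring]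
          exact Real.sqrt_sq (by positivity)
        have h3 : κ * μ * D ≤ M ^ 4 := by
          refine le_of_mul_le_mul_right ?_ hμ
          nlinarith
        have h4 : κ * μ * D * (1 / M ^ 8) ≤ 1 / M ^ 4 := by
          refine (mul_le_mul_of_nonneg_right h3 (by positivity)).trans (le_of_eq ?_)
          field_simp
        have h5 := h₂ hMR
        have h6 : C₁ / M ^ 4 = C₁ * (1 / M ^ 4) := by ring
        rw [hsq]
        have h7 : 0 ≤ 1 / M ^ 4 := by positivity
        nlinarith [mul_nonneg (mul_nonneg hκ hD) (sq_nonneg (1 / M ^ 8)), mul_nonneg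
          (by positivity : 0 ≤ R ^ 4) h7]

theorem criticalMassLine_le_three : criticalMassLine ≤ 3 := by
  have h1 : √3 ≤ 1.75 := Real.sqrt_le_iff.2 ⟨by norm_num, by norm_num⟩
  have h2 := Real.pi_lt_d2
  unfold criticalMassLine
  nlinarith [Real.sqrt_nonneg 3, Real.pi_pos]

theorem three_mul_div_criticalMassLine_sq (x : ℝ) :
    3 * (x / criticalMassLine) ^ 2 = (2 / Real.pi) ^ 2 * x ^ 2 := by
  have h : √3 ^ 2 = 3 := Real.sq_sqrt (by norm_num)
  have hpi := Real.pi_pos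
  rw [criticalMassLine, div_pow, div_pow, mul_pow, h]
  field_simp

/-! ### The inequality for Sobolev functions on the graph -/

namespace MetricGraph

variable {V E : Type*} {G : MetricGraph V E} {u : G.Space → ℝ}

theorem continuous_edgeFun (hu : Continuous u) (e : E) : Continuous (edgeFun u e) := by
  let _ : TopologicalSpace V := ⊥
  have h : Continuous (G.edgePoint e) :=
    continuous_quot_mk.comp (continuous_inr.comp continuous_sigmaMk)
  exact (hu.comp h).Icc_extend'

theorem edgeFun_zero (u : G.Space → ℝ) (e : E) :
    edgeFun u e 0 = u (Quot.mk _ (Sum.inl (G.src e))) := by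
  rw [edgeFun, IccExtend_left]
  exact congrArg u (Quot.sound (Glue.src e))

theorem edgeFun_len (u : G.Space → ℝ) (e : E) :
    edgeFun u e (G.len e) = u (Quot.mk _ (Sum.inl (G.tgt e))) := by
  rw [edgeFun, IccExtend_right]
  exact congrArg u (Quot.sound (Glue.tgt e))

theorem integrableOn_edgeFun_pow (hu : Continuous u) (e : E) (p : ℕ) :
    IntegrableOn (fun x => |edgeFun u e x| ^ p) (Ioo 0 (G.len e)) :=
  (((continuous_edgeFun hu e).abs.pow p).integrableOn_Icc).mono_set Ioo_subset_Icc_self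

variable [Fintype E]

theorem derivNormSq_nonneg (u : G.Space → ℝ) : 0 ≤ derivNormSq u :=
  Finset.sum_nonneg fun _ _ => setIntegral_nonneg measurableSet_Ioo fun _ _ => sq_nonneg _

theorem exists_abs_edgeFun_max [Nonempty E] (hu : Continuous u) :
    ∃ e₀, ∃ x₀ ∈ Icc 0 (G.len e₀), ∀ e, ∀ x ∈ Icc 0 (G.len e),
      |edgeFun u e x| ≤ |edgeFun u e₀ x₀| := by
  choose x hx hmax using fun e => isCompact_Icc.exists_isMaxOn
    (nonempty_Icc.2 (G.len_pos e).le) (continuous_edgeFun hu e).abs.continuousOn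
  obtain ⟨e₀, he₀⟩ := Finite.exists_max fun e => |edgeFun u e (x e)|
  exact ⟨e₀, x e₀, hx e₀, fun e y hy => (hmax e hy).trans (he₀ e)⟩

/-- The Gagliardo–Nirenberg inequality with the constant of the real line, up to an error that is
small when the maximum `M` of `|u|` is large. -/
theorem exists_max_lpNormPow_six_le (hterm : ∀ e, ¬ G.IsTerminalEdge e) {r μ : ℝ} (hr : 0 < r)
    (hlen : ∀ e, 4 * r ≤ G.len e) (hμ : 0 < μ) (hμ3 : μ ≤ 3) (hu : InH1Mass μ u) :
    ∃ M, 0 < M ∧ lpNormPow 6 u ≤ M ^ 4 * μ ∧ (24 ≤ r * M ^ 2 →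
      lpNormPow 6 u ≤ (2 / Real.pi) ^ 2 * μ ^ 2 * derivNormSq u + 4 * (16 / r) ^ 4 / M ^ 4) := by
  obtain ⟨⟨hcont, hH1⟩, hmass⟩ := hu
  have : Nonempty E := by
    by_contra hE
    rw [not_nonempty_iff] at hE
    rw [lpNormPow, Finset.univ_eq_empty, Finset.sum_empty] at hmass
    exact hμ.ne hmass
  obtain ⟨e₀, x₀, hx₀, hmax⟩ := exists_abs_edgeFun_max hcont
  set M := |edgeFun u e₀ x₀| with hMdef
  have hM : 0 < M := by
    refine (abs_nonneg _).lt_of_ne' fun h0 => hμ.ne ?_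
    rw [← hmass, lpNormPow]
    refine (Finset.sum_eq_zero fun e _ => ?_).symm
    refine setIntegral_eq_zero_of_forall_eq_zero fun x hx => ?_
    have h1 := hmax e x (Ioo_subset_Icc_self hx)
    rw [hMdef, h0] at h1
    rw [le_antisymm h1 (abs_nonneg _)]
    norm_num
  refine ⟨M, hM, ?_, fun hbig => ?_⟩
  · rw [← hmass, lpNormPow, lpNormPow, Finset.mul_sum]
    refine Finset.sum_le_sum fun e _ => ?_
    rw [← MeasureTheory.integral_const_mul]
    refine setIntegral_mono_on (integrableOn_edgeFun_pow hcont e 6)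
      ((integrableOn_edgeFun_pow hcont e 2).const_mul _) measurableSet_Ioo fun x hx => ?_
    have h1 := hmax e x (Ioo_subset_Icc_self hx)
    rw [show |edgeFun u e x| ^ 6 = |edgeFun u e x| ^ 4 * |edgeFun u e x| ^ 2 by ring]
    gcongr
  · choose F hFac hFd hFeq using fun e => (hH1 e).exists_absolutelyContinuous (G.len_pos e)
      (continuous_edgeFun hcont e).continuousOn
    set g : E → ℝ → ℝ := fun e => weakDeriv (edgeFun u e) 0 (G.len e) with hg
    have hgsq : ∀ e, IntegrableOn (fun x => g e x ^ 2) (Ioo 0 (G.len e)) := fun e =>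
      (hH1 e).hasL2WeakDerivOn.1.integrable_sq
    have hsq : ∀ e, ∫ x in (0 : ℝ)..G.len e, F e x ^ 2 =
        ∫ x in Ioo 0 (G.len e), |edgeFun u e x| ^ 2 := fun e => by
      rw [integral_of_le (G.len_pos e).le, integral_Ioc_eq_integral_Ioo]
      refine setIntegral_congr_fun measurableSet_Ioo fun x hx => ?_
      simp only [hFeq e (Ioo_subset_Icc_self hx), sq_abs]
    have H : ∀ e, BoundedSobolev (F e) (g e) M μ 0 (G.len e) := fun e => by
      refine ⟨hFac e, hFd e, (intervalIntegrable_iff_integrableOn_Ioo_of_le (G.len_pos e).le).2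
        (hgsq e), fun x hx => ?_, ?_⟩
      · rw [hFeq e hx]
        exact hmax e x hx
      · rw [hsq, ← hmass]
        exact Finset.single_le_sum
          (f := fun e => ∫ x in Ioo 0 (G.len e), |edgeFun u e x| ^ 2)
          (fun i _ => setIntegral_nonneg measurableSet_Ioo fun _ _ => by positivity)
          (Finset.mem_univ e)
    have hpi := Real.pi_pos
    -- This k makes the lower bound kπM⁴/2 equal to the term M⁴μ in the energy, and k² is the
    -- desired coefficient.
    set k := 2 * μ / Real.pi with hk
    have hk0 : 0 ≤ k := by positivity
    have hk2 : k ≤ 2 := by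
      rw [hk, div_le_iff₀ hpi]
      linarith [Real.pi_gt_three]
    have key := two_mul_calibration_le_energy hterm (w := fun v => u (Quot.mk _ (Sum.inl v))) H
      (fun e => by rw [hFeq e ⟨le_rfl, (G.len_pos e).le⟩, edgeFun_zero])
      (fun e => by rw [hFeq e ⟨(G.len_pos e).le, le_rfl⟩, edgeFun_len])
      hM hk0 hr hlen (by linarith) hx₀ (by rw [hFeq e₀ hx₀])
    have hint : ∀ e, IntegrableOn (fun x => k ^ 2 * g e x ^ 2 + M ^ 4 * |edgeFun u e x| ^ 2)
        (Ioo 0 (G.len e)) := fun e =>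
      ((hgsq e).const_mul _).add ((integrableOn_edgeFun_pow hcont e 2).const_mul _)
    have hen : ∑ e, ∫ x in (0 : ℝ)..G.len e, energyDensity k M (F e) (g e) x =
        k ^ 2 * derivNormSq u + M ^ 4 * μ - lpNormPow 6 u := by
      rw [← hmass, derivNormSq, lpNormPow, lpNormPow, Finset.mul_sum, Finset.mul_sum,
        ← Finset.sum_add_distrib, ← Finset.sum_sub_distrib]
      refine Finset.sum_congr rfl fun e _ => ?_
      rw [integral_of_le (G.len_pos e).le, integral_Ioc_eq_integral_Ioo,
        ← MeasureTheory.integral_const_mul, ← MeasureTheory.integral_const_mul,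
        ← MeasureTheory.integral_add ((hgsq e).const_mul _)
          ((integrableOn_edgeFun_pow hcont e 2).const_mul _),
        ← MeasureTheory.integral_sub (hint e) (integrableOn_edgeFun_pow hcont e 6)]
      refine setIntegral_congr_fun measurableSet_Ioo fun x hx => ?_
      have h6 : |edgeFun u e x| ^ 6 = edgeFun u e x ^ 6 := Even.pow_abs ⟨3, rfl⟩ _
      simp only [energyDensity, hFeq e (Ioo_subset_Icc_self hx), sq_abs, h6, hg]
      ring
    have herr : 2 * (k * (8 * k / r) ^ 4 / M ^ 4) ≤ 4 * (16 / r) ^ 4 / M ^ 4 := by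
      rw [← mul_div_assoc, ← mul_assoc]
      gcongr <;> linarith
    have hk' : k * (Real.pi / 2 * M ^ 4) = M ^ 4 * μ := by
      rw [hk]
      field_simp
    have hk'' : (2 / Real.pi) ^ 2 * μ ^ 2 = k ^ 2 := by rw [hk]; ring
    rw [hk'']
    linarith

end MetricGraph

theorem mainTheorem4 {V E : Type*} [Finite V] [Fintype E] (G : MetricGraph V E)
    (hconn : G.Connected) (hterm : ∀ e, ¬ G.IsTerminalEdge e) :
    ∃ C : ℝ, 0 < C ∧ ∀ μ : ℝ, 0 < μ → μ ≤ criticalMassLine →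
      ∀ u : G.Space → ℝ, MetricGraph.InH1Mass μ u →
        ∃ θ ∈ Set.Icc (0 : ℝ) μ,
          MetricGraph.lpNormPow 6 u ≤
            3 * ((μ - θ) / criticalMassLine) ^ 2 * MetricGraph.derivNormSq u
              + C * θ ^ (1 / 2 : ℝ) := by
  obtain ⟨r, hr, hlen⟩ : ∃ r : ℝ, 0 < r ∧ ∀ e, 4 * r ≤ G.len e := by
    rcases isEmpty_or_nonempty E with hE | hE
    · exact ⟨1, one_pos, fun e => isEmptyElim e⟩
    · obtain ⟨e, he⟩ := Finite.exists_min G.len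
      exact ⟨G.len e / 4, by linarith [G.len_pos e], fun e' => by linarith [he e']⟩
  refine ⟨4 * (16 / r) ^ 4 + 2 * (1 + 24 / r) ^ 4 + 2, by positivity, fun μ hμ hle u hu => ?_⟩
  have hμ3 := hle.trans criticalMassLine_le_three
  obtain ⟨M, hM, h₁, h₂⟩ := MetricGraph.exists_max_lpNormPow_six_le hterm hr hlen hμ hμ3 hu
  have h24 : 0 < 24 / r := by positivity
  -- M ≥ R ≥ 1 gives M² ≥ M ≥ 24/r, the largeness needed by the tails since 8μ ≤ 24.
  obtain ⟨θ, hθ, h⟩ := exists_mass_defect (R := 1 + 24 / r) hμ hμ3 hM (by linarith)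
    (by positivity) (sq_nonneg (2 / Real.pi)) (MetricGraph.derivNormSq_nonneg u) h₁ fun hMR =>
    h₂ (by
      have e1 : 24 / r ≤ M ^ 2 := by nlinarith
      rw [div_le_iff₀ hr] at e1
      linarith)
  refine ⟨θ, hθ, ?_⟩
  rwa [three_mul_div_criticalMassLine_sq, ← Real.sqrt_eq_rpow]
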